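/- Let $a,b,\lambda>0$, $q\ge 0$ and let $N\ge 1$ be an integer. Let $T_1<T_2<\dots$ be the arrival epochs of a Poisson process $N(t)$ of rate $\lambda$ (i.i.d. exponential($\lambda$) interarrival times). For initial capital $x$, let $U^b$ be the surplus process controlled by a dividend barrier at $b$, $$U^b(t)=x-t+\sum_{i=1}^{N(t)}aU^b(T_i-)-L^b(t),$$ where $L^b(t)$ is the cumulative overflow above $b$: at each arrival the surplus $u=U^b(T_i-)$ jumps to $\min((1+a)u,b)$ and the amount $\max((1+a)u-b,0)$ is paid as dividend (an initial overflow $\max(x-b,0)$ is paid at time $0$). Put $L_n=b/(a+1)^n$, let $\tau=\inf\{t\ge0:U^b(t)=L_N\}$, and let $$v_N(x)=\mathbb E_x\Big[\int_{[0,\tau]}e^{-qt}\,{\rm d}L^b(t)\Big],\qquad v_n:=v_N(L_n)\quad(0\le n\le N);$$ in particular $v_0=v_N(b)$. Let $(f\circledast h)(y)=\int_0^y f(t)h(y-t)\,{\rm d}t$, $\bar G_c(t)=e^{-(\lambda+q)ct}$, $g_c(t)=\lambda c\,e^{-(\lambda+q)ct}$, $\mathcal Q(t)=t$, and $$\gamma_j=\bar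 G_{(a+1)^j}\circledast g_{(a+1)^{j-1}}\circledast\cdots\circledast g_1\ (j\ge 0,\ \gamma_0=\bar G_1).$$ Theorem. The expectation $v_N(x)$ is finite for $L_N\le x\le b$, and $v_N(L_N)=0$. For $1\le n\le N$ and $L_n<x\le L_{n-1}$, $$v_N(x)=\sum_{j=0}^{n-1}\gamma_j(x-L_n)\,v_{n-j}+\big(1\circledast g_{(a+1)^{n-1}}\circledast\cdots\circledast g_1\big)(x-L_n)\,v_N(b)+\big((a+1)^n\mathcal Q\circledast g_{(a+1)^{n-1}}\circledast\cdots\circledast g_1\big)(x-L_n).$$ Moreover, for $n=0,\dots,N-1$ put $s_n=L_n-L_{n+1}=\frac{b}{(a+1)^n}\big(1-\frac1{a+1}\big)$ and $$\gamma_{j,n}=\gamma_j(s_n),\quad \omega_{n+1}=\big(1\circledast g_{(a+1)^{n}}\circledast\cdots\circledast g_1\big)(s_n),\quad \delta_{n+1}=\big((a+1)^{n+1}\mathcal Q\circledast g_{(a+1)^{n}}\circledast\cdots\circledast g_1\big)(s_n).$$ Let $\Psi$ be the $N\times N$ matrix whose row $n$ ($n=0,\dots,N-1$) consists of the first $N$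 entries of $(\omega_{n+1},\gamma_{n,n},\gamma_{n-1,n},\dots,\gamma_{0,n},0,0,\dots)$, and let $\Delta=(\delta_1,\dots,\delta_N)^T$. Then $V=(v_0,\dots,v_{N-1})^T$ satisfies $V=\Psi V+\Delta$; the matrix $I-\Psi$ is invertible, and hence $V=(I-\Psi)^{-1}\Delta$. -/

import Mathlib

open MeasureTheory ProbabilityTheory Set
open scoped ENNReal

noncomputable section

namespace DualRisk

/-! ### Arrival times

`w : ℕ → ℝ` is a sequence of interarrival times; `w k` is the time between the `k`-th and the
`(k+1)`-st arrival (the "0-th arrival" being time `0`). -/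

/-- Epoch of the `k`-th arrival, `k = 1, 2, …`; `arrivalTime w 0 = 0`. -/
def arrivalTime (w : ℕ → ℝ) (k : ℕ) : ℝ := ∑ i ∈ Finset.range k, w i

/-- `N(t)`, the number of arrivals in `[0, t]`. -/
def arrivalCount (w : ℕ → ℝ) (t : ℝ) : ℕ := {k : ℕ | arrivalTime w (k + 1) ≤ t}.ncard

/-! ### The surplus process controlled by a dividend barrier at `b`

The surplus decreases at unit rate between arrivals; a surplus `u` just before an arrival is turned
into `(1 + a) u`, and everything above `b` is paid out immediately as dividend. -/

/-- Surplus right after the `k`-th arrival (and after paying the overflow at that time);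
for `k = 0`, the surplus at time `0`, where a possible initial overflow `x - b` has been paid. -/
def postSurplus (a b x : ℝ) (w : ℕ → ℝ) : ℕ → ℝ
  | 0 => min x b
  | k + 1 => min ((1 + a) * (postSurplus a b x w k - w k)) b

/-- Surplus `U^b(T_{k+1}-)` just before the `(k+1)`-st arrival. -/
def preSurplus (a b x : ℝ) (w : ℕ → ℝ) (k : ℕ) : ℝ := postSurplus a b x w k - w k

/-- Dividend paid at the `k`-th arrival (at time `0` if `k = 0`): the overflow above `b`. -/
def dividend (a b x : ℝ) (w : ℕ → ℝ) : ℕ → ℝ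
  | 0 => max (x - b) 0
  | k + 1 => max ((1 + a) * preSurplus a b x w k - b) 0

/-- `U^b(t)`, the controlled surplus at time `t ≥ 0`, with initial capital `x`. -/
def surplus (a b x : ℝ) (w : ℕ → ℝ) (t : ℝ) : ℝ :=
  postSurplus a b x w (arrivalCount w t) - (t - arrivalTime w (arrivalCount w t))

/-- `L^b(t)`, the cumulative dividends paid up to and including time `t ≥ 0`. -/
def cumDividends (a b x : ℝ) (w : ℕ → ℝ) (t : ℝ) : ℝ :=
  ∑ k ∈ Finset.range (arrivalCount w t + 1), dividend a b x w k

/-- `dL^b`, the Stieltjes measure of the nondecreasing pure jump function `L^b`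
(see `dividendMeasure_Iic`). -/
def dividendMeasure (a b x : ℝ) (w : ℕ → ℝ) : Measure ℝ :=
  Measure.sum fun k => ENNReal.ofReal (dividend a b x w k) • Measure.dirac (arrivalTime w k)

/-- The first time `t ≥ 0` at which `U^b(t)` equals the given level (`∞` if there is none). -/
def hittingTime (a b x level : ℝ) (w : ℕ → ℝ) : ℝ≥0∞ :=
  ⨅ t ∈ {t : ℝ | 0 ≤ t ∧ surplus a b x w t = level}, ENNReal.ofReal t

/-- The level `L_n = b / (a+1)^n`. -/
def level (a b : ℝ) (n : ℕ) : ℝ := b / (a + 1) ^ n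

/-- The discounted dividends `∫_0^τ e^{-qt} dL^b(t)`, where `τ` is the first time at which `U^b`
equals `L_N`. -/
def discountedDividends (a b q : ℝ) (N : ℕ) (x : ℝ) (w : ℕ → ℝ) : ℝ≥0∞ :=
  ∫⁻ t in {t : ℝ | 0 ≤ t ∧ ENNReal.ofReal t ≤ hittingTime a b x (level a b N) w},
    ENNReal.ofReal (Real.exp (-q * t)) ∂(dividendMeasure a b x w)

/-- The expected discounted dividends paid until `L_N` is reached, as an element of `[0, ∞]`;
`ξ k` are the random interarrival times and `x` is the initial capital. -/
def expectedDividends {Ω : Type*} [MeasurableSpace Ω] (P : Measure Ω) (ξ : ℕ → Ω → ℝ)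
    (a b q : ℝ) (N : ℕ) (x : ℝ) : ℝ≥0∞ :=
  ∫⁻ ω, discountedDividends a b q N x (fun k => ξ k ω) ∂P

/-- `v_N(x)`, as a real number. -/
def valueN {Ω : Type*} [MeasurableSpace Ω] (P : Measure Ω) (ξ : ℕ → Ω → ℝ)
    (a b q : ℝ) (N : ℕ) (x : ℝ) : ℝ :=
  (expectedDividends P ξ a b q N x).toReal

/-! The two facts below tie the explicit description of the controlled process to its usual
defining equations. -/

/-- `U^b(t) = x - t + ∑_{i=1}^{N(t)} a U^b(T_i-) - L^b(t)`. -/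
theorem surplus_eq (a b x : ℝ) (w : ℕ → ℝ) (t : ℝ) :
    surplus a b x w t =
      x - t + ∑ k ∈ Finset.range (arrivalCount w t), a * preSurplus a b x w k
        - cumDividends a b x w t := by
  have key : ∀ n : ℕ, postSurplus a b x w n + arrivalTime w n =
      x + ∑ k ∈ Finset.range n, a * preSurplus a b x w k
        - ∑ k ∈ Finset.range (n + 1), dividend a b x w k := by
    intro n
    induction n with
    | zero =>
      simp only [postSurplus, arrivalTime, dividend, Finset.sum_range_zero, zero_add,
        Finset.sum_range_one]
      rcases le_total x b with h | h
      · rw [min_eq_left h, max_eq_right (by linarith)]; ring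
      · rw [min_eq_right h, max_eq_left (by linarith)]; ring
    | succ n ih =>
      rw [Finset.sum_range_succ, Finset.sum_range_succ _ (n + 1)]
      have h1 : postSurplus a b x w (n + 1) =
          (1 + a) * preSurplus a b x w n - dividend a b x w (n + 1) := by
        change min ((1 + a) * preSurplus a b x w n) b =
          (1 + a) * preSurplus a b x w n - max ((1 + a) * preSurplus a b x w n - b) 0
        rcases le_total ((1 + a) * preSurplus a b x w n) b with h | h
        · rw [min_eq_left h, max_eq_right (by linarith)]; ring
        · rw [min_eq_right h, max_eq_left (by linarith)]; ring
      have h2 : arrivalTime w (n + 1) = arrivalTime w n + w n := by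
        simp [arrivalTime, Finset.sum_range_succ]
      have h3 : preSurplus a b x w n = postSurplus a b x w n - w n := rfl
      rw [h1, h2]
      linarith
  have := key (arrivalCount w t)
  simp only [surplus, cumDividends]
  linarith

/-- `dL^b((-∞, t]) = L^b(t)` on every path with nonnegative interarrival times and only finitely
many arrivals before `t`. -/
theorem dividendMeasure_Iic (a b x : ℝ) (w : ℕ → ℝ) (hw : ∀ k, 0 ≤ w k) (t : ℝ) (ht : 0 ≤ t)
    (hfin : {k : ℕ | arrivalTime w (k + 1) ≤ t}.Finite) :
    dividendMeasure a b x w (Iic t) = ENNReal.ofReal (cumDividends a b x w t) := by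
  have hmono : Monotone (arrivalTime w) := monotone_nat_of_le_succ fun n => by
    simp only [arrivalTime, Finset.sum_range_succ]
    linarith [hw n]
  obtain ⟨m, hm⟩ : ∃ m : ℕ, {k : ℕ | arrivalTime w (k + 1) ≤ t} = Iio m := by
    have hl : IsLowerSet {k : ℕ | arrivalTime w (k + 1) ≤ t} := fun i j hij hi =>
      (hmono (by omega : j + 1 ≤ i + 1)).trans hi
    rcases hl.eq_univ_or_Iio with h | ⟨m, h⟩
    · exact absurd (h ▸ hfin) Set.infinite_univ
    · exact ⟨m, h⟩
  have hcount : arrivalCount w t = m := by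
    rw [arrivalCount, hm, ← Finset.coe_Iio, Set.ncard_coe_finset, Nat.card_Iio]
  have hiff : ∀ k, arrivalTime w k ≤ t ↔ k < m + 1 := by
    intro k
    cases k with
    | zero => simp [arrivalTime, ht]
    | succ k =>
      have : k ∈ {k : ℕ | arrivalTime w (k + 1) ≤ t} ↔ k ∈ Iio m := by rw [hm]
      simpa using this
  have hnn : ∀ k, 0 ≤ dividend a b x w k := by
    intro k
    cases k <;> exact le_max_right _ _
  rw [dividendMeasure, Measure.sum_apply _ measurableSet_Iic, cumDividends, hcount,
    ENNReal.ofReal_sum_of_nonneg fun k _ => hnn k, tsum_eq_sum (s := Finset.range (m + 1))]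
  · refine Finset.sum_congr rfl fun k hk => ?_
    have : arrivalTime w k ≤ t := (hiff k).2 (Finset.mem_range.1 hk)
    simp [Measure.dirac_apply' _ measurableSet_Iic, this]
  · intro k hk
    have : ¬ arrivalTime w k ≤ t := fun h => hk (Finset.mem_range.2 ((hiff k).1 h))
    simp [Measure.dirac_apply' _ measurableSet_Iic, this]

/-! ### Convolutions -/

/-- Convolution of functions on the half line: `(f ⊛ h)(y) = ∫_0^y f(t) h(y - t) dt` for `y > 0`. -/
def conv (f h : ℝ → ℝ) : ℝ → ℝ := posConvolution f h (ContinuousLinearMap.mul ℝ ℝ) volume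

/-- `convChain g f k = f ⊛ g_{k-1} ⊛ … ⊛ g_1 ⊛ g_0` (and `f` if `k = 0`). -/
def convChain (g : ℕ → ℝ → ℝ) (f : ℝ → ℝ) : ℕ → ℝ → ℝ
  | 0 => f
  | k + 1 => conv (convChain (fun i => g (i + 1)) f k) (g 0)

/-- `Ḡ_c(t) = e^{-(λ+q)ct}`. -/
def Gbar (lam q c t : ℝ) : ℝ := Real.exp (-(lam + q) * c * t)

/-- `g_c(t) = λ c e^{-(λ+q)ct}`. -/
def gdens (lam q c t : ℝ) : ℝ := lam * c * Real.exp (-(lam + q) * c * t)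

/-- `f ⊛ g_{(a+1)^{k-1}} ⊛ … ⊛ g_{a+1} ⊛ g_1` (and `f` if `k = 0`). -/
def gChain (a lam q : ℝ) (f : ℝ → ℝ) (k : ℕ) : ℝ → ℝ :=
  convChain (fun i => gdens lam q ((a + 1) ^ i)) f k

/-- `γ_j = Ḡ_{(a+1)^j} ⊛ g_{(a+1)^{j-1}} ⊛ … ⊛ g_1`, with `γ_0 = Ḡ_1`. -/
def gammaFun (a lam q : ℝ) (j : ℕ) : ℝ → ℝ :=
  gChain a lam q (Gbar lam q ((a + 1) ^ j)) j

/-- `1 ⊛ g_{(a+1)^{n-1}} ⊛ … ⊛ g_1`. -/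
def omegaFun (a lam q : ℝ) (n : ℕ) : ℝ → ℝ :=
  gChain a lam q (fun _ => 1) n

/-- `(a+1)^n 𝒬 ⊛ g_{(a+1)^{n-1}} ⊛ … ⊛ g_1`, where `𝒬(y) = y`. -/
def deltaFun (a lam q : ℝ) (n : ℕ) : ℝ → ℝ :=
  gChain a lam q (fun y => (a + 1) ^ n * y) n

/-! ### The linear system for `v_0, …, v_{N-1}` -/

/-- `(b / (a+1)^n) (1 - 1/(a+1)) = L_n - L_{n+1}`. -/
def gap (a b : ℝ) (n : ℕ) : ℝ := b / (a + 1) ^ n * (1 - 1 / (a + 1))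

/-- The matrix `Ψ`, whose row `n` is `(ω_{n+1}, γ_{n,n}, γ_{n-1,n}, …, γ_{0,n}, 0, …, 0)`, cut off
after `N` entries; here `ω_{n+1} = omegaFun (n+1)` and `γ_{j,n} = γ_j`, taken at
`L_n - L_{n+1}`. -/
def Psi (a b lam q : ℝ) (N : ℕ) : Matrix (Fin N) (Fin N) ℝ :=
  Matrix.of fun n k =>
    if (k : ℕ) = 0 then omegaFun a lam q (n + 1) (gap a b n)
    else if (k : ℕ) ≤ n + 1 then gammaFun a lam q (n + 1 - k) (gap a b n)
    else 0

/-- The vector `Δ = (δ_1, …, δ_N)`, with `δ_{n+1} = deltaFun (n+1)` taken at `L_n - L_{n+1}`. -/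
def Delta (a b lam q : ℝ) (N : ℕ) : Fin N → ℝ :=
  fun n => deltaFun a lam q (n + 1) (gap a b n)

end DualRisk

end

namespace DualRisk

/-! ### Convolution chains -/

/-! Write u for the value function and condition on the first arrival. From x in [L_N, b] the
surplus becomes (1+a)(x - s) at an arrival at time s, and nothing is paid if s > x - L_N. This gives
the renewal equation `payoffSum_eq_integral`. Cutting its integral at the moment when the surplus
passes a lower level z (lack of memory) turns it into `payoffSum_add`: u(z+y) is Ḡ_1(y) u(z) plus a
convolution of g_1 with t ↦ u((1+a)z + (a+1)t).

For z = L_{n+1} the argument is L_n + (a+1)t, so u on one interval between levels is determined by u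
on the interval above it. Above b, u(b+y) = u(b) + y. Dilation by a+1 sends g_c to g_{(a+1)c}, so
the recursion unrolls into the chains γ_j, ω, δ: `expansion_succ` is the same recursion as
`payoffSum_add`, and `payoffSum_eq_expansion` is the induction.

Evaluating at the upper end of each interval gives V = ΨV + Δ. The rows of Ψ are nonnegative with
sum at most 1, and row n carries the positive weight Ḡ_1 on v_{n+1}. For a solution of V = ΨV, a
maximum of |v_k| therefore propagates from k to k+1 until it reaches v_N = 0, so I - Ψ is injective
(`isUnit_one_sub_Psi`).

Finiteness: k arrivals before L_N is reached need k interarrival times at most b, which bounds the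
k-th expected payoff by a geometric sequence. -/

theorem conv_apply (f h : ℝ → ℝ) {y : ℝ} (hy : 0 ≤ y) :
    conv f h y = ∫ t in (0 : ℝ)..y, f t * h (y - t) := by
  rcases hy.eq_or_lt with rfl | hy
  · simp [conv, posConvolution]
  · simp [conv, posConvolution, hy]

theorem conv_of_nonpos (f h : ℝ → ℝ) {y : ℝ} (hy : y ≤ 0) : conv f h y = 0 := by
  simp [conv, posConvolution, not_lt.2 hy]

theorem continuous_conv {f h : ℝ → ℝ} (hf : Continuous f) (hh : Continuous h) :
    Continuous (conv f h) := by
  have : conv f h = fun y => ∫ t in (0 : ℝ)..max y 0, f t * h (max y 0 - t) := by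
    ext y
    rcases le_total 0 y with hy | hy
    · rw [conv_apply f h hy, max_eq_left hy]
    · simp [conv_of_nonpos f h hy, max_eq_right hy]
  -- Clipping at 0 yields one formula on the whole line, to which continuity of parametric integrals
  -- applies.
  rw [this]
  refine intervalIntegral.continuous_parametric_intervalIntegral_of_continuous ?_ (by fun_prop)
  change Continuous fun p : ℝ × ℝ => f p.2 * h (max p.1 0 - p.2)
  fun_prop

theorem conv_nonneg {f h : ℝ → ℝ} (hf : ∀ t, 0 ≤ f t) (hh : ∀ t, 0 ≤ h t) (y : ℝ) :
    0 ≤ conv f h y := by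
  rcases le_total 0 y with hy | hy
  · rw [conv_apply f h hy]
    exact intervalIntegral.integral_nonneg hy fun t _ => mul_nonneg (hf t) (hh _)
  · rw [conv_of_nonpos f h hy]

theorem conv_congr {f f' h : ℝ → ℝ} {y : ℝ} (hff : ∀ t, 0 ≤ t → t ≤ y → f t = f' t) :
    conv f h y = conv f' h y := by
  rcases le_total 0 y with hy | hy
  · rw [conv_apply f h hy, conv_apply f' h hy]
    refine intervalIntegral.integral_congr fun t ht => ?_
    rw [uIcc_of_le hy] at ht
    simp only [hff t ht.1 ht.2]
  · rw [conv_of_nonpos f h hy, conv_of_nonpos f' h hy]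

theorem conv_add {f f' h : ℝ → ℝ} (hf : Continuous f) (hf' : Continuous f') (hh : Continuous h)
    (y : ℝ) : conv (fun t => f t + f' t) h y = conv f h y + conv f' h y := by
  rcases le_total 0 y with hy | hy
  · simp only [conv_apply _ h hy, add_mul]
    exact intervalIntegral.integral_add (Continuous.intervalIntegrable (by fun_prop) _ _)
      (Continuous.intervalIntegrable (by fun_prop) _ _)
  · simp [conv_of_nonpos _ h hy]

theorem conv_mul_const (f h : ℝ → ℝ) (c y : ℝ) :
    conv (fun t => f t * c) h y = conv f h y * c := by
  rcases le_total 0 y with hy | hy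
  · simp only [conv_apply _ h hy, mul_right_comm _ c]
    exact intervalIntegral.integral_mul_const _ _
  · simp [conv_of_nonpos _ h hy]

theorem conv_sum {ι : Type*} (s : Finset ι) {f : ι → ℝ → ℝ} {h : ℝ → ℝ}
    (hf : ∀ i, Continuous (f i)) (hh : Continuous h) (y : ℝ) :
    conv (fun t => ∑ i ∈ s, f i t) h y = ∑ i ∈ s, conv (f i) h y := by
  rcases le_total 0 y with hy | hy
  · simp only [conv_apply _ h hy, Finset.sum_mul]
    exact intervalIntegral.integral_finsetSum fun i _ =>
      (by have := hf i; fun_prop : Continuous fun t => f i t * h (y - t)).intervalIntegrable _ _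
  · simp [conv_of_nonpos _ h hy]

theorem conv_comp_mul (f h : ℝ → ℝ) {c : ℝ} (hc : 0 < c) (y : ℝ) :
    conv f h (c * y) = conv (fun t => f (c * t)) (fun t => c * h (c * t)) y := by
  rcases le_total 0 y with hy | hy
  · rw [conv_apply _ _ hy, conv_apply _ _ (by positivity)]
    have := intervalIntegral.mul_integral_comp_mul_left (f := fun t => f t * h (c * y - t))
      (a := 0) (b := y) c
    rw [mul_zero] at this
    rw [← this, ← intervalIntegral.integral_const_mul]
    refine intervalIntegral.integral_congr fun t _ => ?_
    simp only [mul_sub]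
    ring
  · rw [conv_of_nonpos _ _ hy, conv_of_nonpos _ _ (mul_nonpos_of_nonneg_of_nonpos hc.le hy)]

theorem convChain_comp_mul {c : ℝ} (hc : 0 < c) (k : ℕ) (g : ℕ → ℝ → ℝ) (f : ℝ → ℝ) (y : ℝ) :
    convChain g f k (c * y) =
      convChain (fun i t => c * g i (c * t)) (fun t => f (c * t)) k y := by
  induction k generalizing g y with
  | zero => rfl
  | succ k ih =>
    simp only [convChain]
    rw [conv_comp_mul _ _ hc]
    simp only [ih]

theorem continuous_convChain {g : ℕ → ℝ → ℝ} {f : ℝ → ℝ} (hg : ∀ i, Continuous (g i))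
    (hf : Continuous f) (k : ℕ) : Continuous (convChain g f k) := by
  induction k generalizing g with
  | zero => exact hf
  | succ k ih => exact continuous_conv (ih fun i => hg (i + 1)) (hg 0)

theorem convChain_nonneg {g : ℕ → ℝ → ℝ} {f : ℝ → ℝ} (hg : ∀ i t, 0 ≤ g i t)
    (hf : ∀ t, 0 ≤ f t) (k : ℕ) (y : ℝ) : 0 ≤ convChain g f k y := by
  induction k generalizing g y with
  | zero => exact hf y
  | succ k ih => exact conv_nonneg (ih fun i => hg (i + 1)) (hg 0) y

theorem continuous_gdens (lam q c : ℝ) : Continuous (gdens lam q c) := by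
  unfold gdens; fun_prop

theorem continuous_Gbar (lam q c : ℝ) : Continuous (Gbar lam q c) := by
  unfold Gbar; fun_prop

theorem continuous_gChain (a lam q : ℝ) {f : ℝ → ℝ} (hf : Continuous f) (k : ℕ) :
    Continuous (gChain a lam q f k) :=
  continuous_convChain (fun _ => continuous_gdens _ _ _) hf k

theorem continuous_gammaFun (a lam q : ℝ) (j : ℕ) : Continuous (gammaFun a lam q j) :=
  continuous_gChain a lam q (continuous_Gbar _ _ _) j

theorem continuous_omegaFun (a lam q : ℝ) (n : ℕ) : Continuous (omegaFun a lam q n) :=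
  continuous_gChain a lam q continuous_const n

theorem continuous_deltaFun (a lam q : ℝ) (n : ℕ) : Continuous (deltaFun a lam q n) :=
  continuous_gChain a lam q (by fun_prop) n

theorem gChain_nonneg {a lam : ℝ} (q : ℝ) (ha : 0 < a) (hlam : 0 < lam) {f : ℝ → ℝ}
    (hf : ∀ t, 0 ≤ f t) (k : ℕ) (y : ℝ) : 0 ≤ gChain a lam q f k y :=
  convChain_nonneg (fun i t => by unfold gdens; positivity) hf k y

theorem gammaFun_nonneg {a lam : ℝ} (q : ℝ) (ha : 0 < a) (hlam : 0 < lam) (j : ℕ) (y : ℝ) :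
    0 ≤ gammaFun a lam q j y :=
  gChain_nonneg q ha hlam (fun _ => (Real.exp_pos _).le) j y

theorem omegaFun_nonneg {a lam : ℝ} (q : ℝ) (ha : 0 < a) (hlam : 0 < lam) (n : ℕ) (y : ℝ) :
    0 ≤ omegaFun a lam q n y :=
  gChain_nonneg q ha hlam (fun _ => zero_le_one) n y

/-- The scaling that links consecutive chains. -/
theorem gChain_succ {a : ℝ} (lam q : ℝ) (ha : 0 < a) (f : ℝ → ℝ) (k : ℕ) :
    gChain a lam q (fun t => f ((a + 1) * t)) (k + 1) =
      conv (fun t => gChain a lam q f k ((a + 1) * t)) (gdens lam q 1) := by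
  have hc : 0 < a + 1 := by linarith
  -- Dilation raises the index of each g by one, which leaves room for the new factor g_1 at the end
  -- of the chain.
  have h : (fun (i : ℕ) (t : ℝ) => (a + 1) * gdens lam q ((a + 1) ^ i) ((a + 1) * t)) =
      fun i => gdens lam q ((a + 1) ^ (i + 1)) := by
    ext i t
    simp only [gdens, pow_succ]
    rw [show -(lam + q) * (a + 1) ^ i * ((a + 1) * t) =
      -(lam + q) * ((a + 1) ^ i * (a + 1)) * t by ring]
    ring
  simp only [gChain, convChain_comp_mul hc, h, convChain, pow_zero]

theorem gammaFun_zero (a lam q y : ℝ) : gammaFun a lam q 0 y = Gbar lam q 1 y := by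
  simp [gammaFun, gChain, convChain]

theorem gammaFun_succ {a : ℝ} (lam q : ℝ) (ha : 0 < a) (j : ℕ) :
    gammaFun a lam q (j + 1) =
      conv (fun t => gammaFun a lam q j ((a + 1) * t)) (gdens lam q 1) := by
  rw [gammaFun, gammaFun, ← gChain_succ lam q ha]
  congr 1
  ext t
  simp only [Gbar, pow_succ]
  congr 1
  ring

theorem omegaFun_succ {a : ℝ} (lam q : ℝ) (ha : 0 < a) (n : ℕ) :
    omegaFun a lam q (n + 1) =
      conv (fun t => omegaFun a lam q n ((a + 1) * t)) (gdens lam q 1) := by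
  rw [omegaFun, omegaFun, ← gChain_succ lam q ha]

theorem deltaFun_succ {a : ℝ} (lam q : ℝ) (ha : 0 < a) (n : ℕ) :
    deltaFun a lam q (n + 1) =
      conv (fun t => deltaFun a lam q n ((a + 1) * t)) (gdens lam q 1) := by
  rw [deltaFun, deltaFun, ← gChain_succ lam q ha]
  congr 1
  ext t
  ring

/-- The right-hand side of the convolution expansion, with coefficients `v`, and with the
contribution of the forcing term multiplied by `d`. -/
noncomputable def expansion (a lam q d : ℝ) (v : ℕ → ℝ) (n : ℕ) (y : ℝ) : ℝ :=
  (∑ j ∈ Finset.range n, gammaFun a lam q j y * v (n - j)) + omegaFun a lam q n y * v 0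
    + deltaFun a lam q n y * d

theorem expansion_zero (a lam q d : ℝ) (v : ℕ → ℝ) (y : ℝ) :
    expansion a lam q d v 0 y = v 0 + y * d := by
  simp [expansion, omegaFun, deltaFun, gChain, convChain]

theorem continuous_expansion (a lam q d : ℝ) (v : ℕ → ℝ) (n : ℕ) :
    Continuous (expansion a lam q d v n) := by
  unfold expansion
  have h1 := continuous_gammaFun a lam q
  have h2 := continuous_omegaFun a lam q n
  have h3 := continuous_deltaFun a lam q n
  fun_prop

/-- The term j = 0 splits off as Ḡ_1; every other chain arises from its predecessor by dilation and
convolution with g_1, and `conv` is linear. -/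
theorem expansion_succ {a : ℝ} (lam q : ℝ) (ha : 0 < a) (d : ℝ) (v : ℕ → ℝ) (n : ℕ) (y : ℝ) :
    expansion a lam q d v (n + 1) y = Gbar lam q 1 y * v (n + 1) +
      conv (fun t => expansion a lam q d v n ((a + 1) * t)) (gdens lam q 1) y := by
  have hg := continuous_gdens lam q 1
  have h1 := continuous_gammaFun a lam q
  have h2 := continuous_omegaFun a lam q n
  have h3 := continuous_deltaFun a lam q n
  unfold expansion
  rw [conv_add (by fun_prop) (by fun_prop) hg, conv_add (by fun_prop) (by fun_prop) hg,
    conv_sum _ (fun i => by fun_prop) hg, Finset.sum_range_succ']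
  simp only [conv_mul_const, gammaFun_zero, gammaFun_succ lam q ha, omegaFun_succ lam q ha,
    deltaFun_succ lam q ha, Nat.add_sub_add_right, Nat.sub_zero]
  ring

/-- Replacing f by 1 and the factor λ of g_1 by λ + q only enlarges the convolution, which then
integrates to exactly 1 - Ḡ_1(y). -/
theorem Gbar_add_conv_le_one {lam q : ℝ} (hlam : 0 < lam) (hq : 0 ≤ q) {f : ℝ → ℝ}
    (hf : Continuous f) (hf1 : ∀ t, 0 ≤ t → f t ≤ 1) {y : ℝ} (hy : 0 ≤ y) :
    Gbar lam q 1 y + conv f (gdens lam q 1) y ≤ 1 := by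
  have hder : ∀ t ∈ uIcc 0 y, HasDerivAt (fun t => Real.exp (-(lam + q) * (y - t)))
      ((lam + q) * Real.exp (-(lam + q) * (y - t))) t := fun t _ => by
    have := (((hasDerivAt_id t).const_sub y).const_mul (-(lam + q))).exp
    simp only [id] at this
    convert this using 1
    ring
  have hint := intervalIntegral.integral_eq_sub_of_hasDerivAt hder
    (Continuous.intervalIntegrable (by fun_prop) _ _)
  have hle : conv f (gdens lam q 1) y ≤
      ∫ t in (0 : ℝ)..y, (lam + q) * Real.exp (-(lam + q) * (y - t)) := by
    rw [conv_apply _ _ hy]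
    have hg := continuous_gdens lam q 1
    refine intervalIntegral.integral_mono_on hy (Continuous.intervalIntegrable (by fun_prop) _ _)
      (Continuous.intervalIntegrable (by fun_prop) _ _) fun t ht => ?_
    simp only [gdens, mul_one]
    have h1 := hf1 t ht.1
    have h2 := Real.exp_pos (-(lam + q) * (y - t))
    have h3 : f t * (lam * Real.exp (-(lam + q) * (y - t))) ≤
      1 * (lam * Real.exp (-(lam + q) * (y - t))) :=
        mul_le_mul_of_nonneg_right h1 (by positivity)
    nlinarith
  rw [hint] at hle
  simp only [sub_self, mul_zero, Real.exp_zero, sub_zero] at hle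
  simp only [Gbar, mul_one]
  linarith

/-- This is the row-sum bound for Ψ: the weights γ_j and ω total at most 1. -/
theorem expansion_one_le_one {a lam q : ℝ} (ha : 0 < a) (hlam : 0 < lam) (hq : 0 ≤ q) (n : ℕ)
    {y : ℝ} (hy : 0 ≤ y) : expansion a lam q 0 (fun _ => 1) n y ≤ 1 := by
  induction n generalizing y with
  | zero => simp [expansion_zero]
  | succ n ih =>
    rw [expansion_succ lam q ha, mul_one]
    refine Gbar_add_conv_le_one hlam hq ?_ (fun t ht => ih (by positivity)) hy
    exact (continuous_expansion _ _ _ _ _ _).comp (by fun_prop)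

/-! ### The linear system -/

/-- Multiplication by `Ψ` in terms of the extension of the vector by `0`. -/
theorem Psi_mulVec (a b lam q : ℝ) (N : ℕ) (v : ℕ → ℝ) (hv : v N = 0) (n : Fin N) :
    (Psi a b lam q N).mulVec (fun k : Fin N => v k) n =
      expansion a lam q 0 v (n + 1) (gap a b n) := by
  obtain ⟨n, hn⟩ := n
  set F : ℕ → ℝ := fun k =>
    (if k = 0 then omegaFun a lam q (n + 1) (gap a b n)
    else if k ≤ n + 1 then gammaFun a lam q (n + 1 - k) (gap a b n) else 0) * v k with hF
  have h1 : (Psi a b lam q N).mulVec (fun k : Fin N => v k) ⟨n, hn⟩ =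
      ∑ k ∈ Finset.range N, F k := by
    rw [Finset.sum_range]
    simp [Matrix.mulVec, dotProduct, Psi, hF]
  -- Only the last row is truncated by the cut-off after N entries; its missing entry in column N
  -- would multiply v_N = 0.
  have h2 : ∑ k ∈ Finset.range N, F k = ∑ k ∈ Finset.range (N + 1), F k := by
    rw [Finset.sum_range_succ]; simp [hF, hv]
  have h3 : ∑ k ∈ Finset.range (N + 1), F k = ∑ k ∈ Finset.range (n + 2), F k := by
    symm
    refine Finset.sum_subset (Finset.range_mono (by omega)) fun k _ hk => ?_
    have : n + 2 ≤ k := by simpa using hk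
    simp [hF, show k ≠ 0 by omega, show ¬ k ≤ n + 1 by omega]
  rw [h1, h2, h3, Finset.sum_range_succ', expansion, ← Finset.sum_range_reflect]
  simp only [mul_zero, add_zero]
  congr 1
  · refine Finset.sum_congr rfl fun k hk => ?_
    have hk : k < n + 1 := by simpa using hk
    have e1 : n + 1 - 1 - k + 1 = n + 1 - k := by omega
    have e2 : n + 1 - (n + 1 - k) = k := by omega
    simp only [hF, e1, e2]
    rw [if_neg (by omega), if_pos (by omega)]

theorem gap_pos {a b : ℝ} (ha : 0 < a) (hb : 0 < b) (n : ℕ) : 0 < gap a b n := by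
  have : 1 / (a + 1) < 1 := by rw [div_lt_one (by linarith)]; linarith
  unfold gap
  exact mul_pos (by positivity) (by linarith)

/-- The weight of v (n + 1) is γ_0 = Ḡ_1. Keeping that term apart makes the bound strict as soon as
|v (n + 1)| < M. -/
theorem abs_expansion_le {a lam q : ℝ} (ha : 0 < a) (hlam : 0 < lam) (hq : 0 ≤ q) {v : ℕ → ℝ}
    {M : ℝ} (hv : ∀ k, |v k| ≤ M) (n : ℕ) {y : ℝ} (hy : 0 ≤ y) :
    |expansion a lam q 0 v (n + 1) y| ≤ (1 - Gbar lam q 1 y) * M + Gbar lam q 1 y * |v (n + 1)| := by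
  have hM : 0 ≤ M := (abs_nonneg _).trans (hv 0)
  have h1 := expansion_one_le_one ha hlam hq (n + 1) hy
  simp only [expansion, Finset.sum_range_succ', gammaFun_zero, mul_one, mul_zero, add_zero,
    Nat.sub_zero] at h1 ⊢
  have h2 : |∑ j ∈ Finset.range n, gammaFun a lam q (j + 1) y * v (n + 1 - (j + 1))| ≤
      (∑ j ∈ Finset.range n, gammaFun a lam q (j + 1) y) * M := by
    rw [Finset.sum_mul]
    refine (Finset.abs_sum_le_sum_abs _ _).trans (Finset.sum_le_sum fun j _ => ?_)
    rw [abs_mul, abs_of_nonneg (gammaFun_nonneg q ha hlam _ _)]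
    exact mul_le_mul_of_nonneg_left (hv _) (gammaFun_nonneg q ha hlam _ _)
  have h3 : |omegaFun a lam q (n + 1) y * v 0| ≤ omegaFun a lam q (n + 1) y * M := by
    rw [abs_mul, abs_of_nonneg (omegaFun_nonneg q ha hlam _ _)]
    exact mul_le_mul_of_nonneg_left (hv _) (omegaFun_nonneg q ha hlam _ _)
  have h4 : |Gbar lam q 1 y * v (n + 1)| = Gbar lam q 1 y * |v (n + 1)| := by
    rw [abs_mul, abs_of_nonneg (show 0 ≤ Gbar lam q 1 y from (Real.exp_pos _).le)]
  refine (abs_add_le _ _).trans ((add_le_add_left (abs_add_le _ _) _).trans ?_)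
  nlinarith [mul_le_mul_of_nonneg_right h1 hM]

theorem isUnit_one_sub_Psi {a b lam q : ℝ} (ha : 0 < a) (hb : 0 < b) (hlam : 0 < lam)
    (hq : 0 ≤ q) (N : ℕ) : IsUnit (1 - Psi a b lam q N) := by
  rw [← Matrix.mulVec_injective_iff_isUnit, ← Matrix.coe_mulVecLin,
    injective_iff_map_eq_zero]
  intro V hV
  rw [Matrix.mulVecLin_apply, Matrix.sub_mulVec, Matrix.one_mulVec, sub_eq_zero] at hV
  set v : ℕ → ℝ := fun k => if h : k < N then V ⟨k, h⟩ else 0 with hv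
  have hVv : V = fun k : Fin N => v k := by ext k; simp [hv]
  have hvN : v N = 0 := by simp [hv]
  have hfix : ∀ n, n < N → v n = expansion a lam q 0 v (n + 1) (gap a b n) := fun n hn => by
    have := congrFun hV ⟨n, hn⟩
    rw [hVv, Psi_mulVec _ _ _ _ _ _ hvN] at this
    exact this
  by_contra hne
  obtain ⟨k₀, hk₀⟩ : ∃ k, V k ≠ 0 := by
    by_contra! h
    exact hne (funext h)
  obtain ⟨m, -, hm⟩ := Finset.exists_max_image Finset.univ (fun k => |V k|) ⟨k₀, Finset.mem_univ _⟩
  have hpos : 0 < |V m| := (abs_pos.2 hk₀).trans_le (hm k₀ (Finset.mem_univ _))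
  have hbound : ∀ k, |v k| ≤ |V m| := fun k => by
    by_cases hk : k < N
    · simpa [hv, hk] using hm ⟨k, hk⟩ (Finset.mem_univ _)
    · simp [hv, hk]
  -- If |v (n + 1)| were below the maximum, its positive weight would push |v n| below the maximum
  -- too.
  have hstep : ∀ n : ℕ, (m : ℕ) ≤ n → n ≤ N → |V m| ≤ |v n| := by
    intro n hn
    induction n, hn using Nat.le_induction with
    | base => intro _; simp [hv]
    | succ n _ ih =>
      intro hnN
      have h1 := ih (by omega)
      have h2 := abs_expansion_le ha hlam hq hbound n (gap_pos ha hb n).le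
      rw [← hfix n (by omega)] at h2
      have h3 : 0 < Gbar lam q 1 (gap a b n) := Real.exp_pos _
      by_contra! h4
      nlinarith [mul_lt_mul_of_pos_left h4 h3]
  have := hstep N m.2.le le_rfl
  rw [hvN, abs_zero] at this
  linarith

/-! ### The discounted dividends along a path -/

theorem arrivalTime_succ (w : ℕ → ℝ) (k : ℕ) :
    arrivalTime w (k + 1) = arrivalTime w k + w k := by
  simp [arrivalTime, Finset.sum_range_succ]

theorem arrivalTime_shift (w : ℕ → ℝ) (k : ℕ) :
    arrivalTime w (k + 1) = w 0 + arrivalTime (fun i => w (i + 1)) k := by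
  simp [arrivalTime, Finset.sum_range_succ', add_comm]

theorem strictMono_arrivalTime {w : ℕ → ℝ} (hw : ∀ k, 0 < w k) : StrictMono (arrivalTime w) :=
  strictMono_nat_of_lt_succ fun n => by rw [arrivalTime_succ]; linarith [hw n]

theorem arrivalCount_eq {w : ℕ → ℝ} (hw : ∀ k, 0 < w k) {t : ℝ} {j : ℕ}
    (h1 : arrivalTime w j ≤ t) (h2 : t < arrivalTime w (j + 1)) : arrivalCount w t = j := by
  have hm := strictMono_arrivalTime hw
  have : {k : ℕ | arrivalTime w (k + 1) ≤ t} = Iio j := by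
    ext k
    constructor
    · intro hk
      have := hm.lt_iff_lt.1 (lt_of_le_of_lt hk h2)
      exact mem_Iio.2 (by omega)
    · intro hk
      exact (hm.monotone (Nat.succ_le_of_lt (mem_Iio.1 hk))).trans h1
  rw [arrivalCount, this, ← Finset.coe_Iio, Set.ncard_coe_finset, Nat.card_Iio]

theorem surplus_eq_of_mem {a b x : ℝ} {w : ℕ → ℝ} (hw : ∀ k, 0 < w k) {t : ℝ} {j : ℕ}
    (h1 : arrivalTime w j ≤ t) (h2 : t < arrivalTime w (j + 1)) :
    surplus a b x w t = postSurplus a b x w j - (t - arrivalTime w j) := by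
  rw [surplus, arrivalCount_eq hw h1 h2]

theorem level_pos {a b : ℝ} (ha : 0 < a) (hb : 0 < b) (n : ℕ) : 0 < level a b n := by
  unfold level; positivity

theorem level_zero (a b : ℝ) : level a b 0 = b := by simp [level]

theorem level_succ {a : ℝ} (ha : 0 < a) (b : ℝ) (n : ℕ) :
    (a + 1) * level a b (n + 1) = level a b n := by
  have : a + 1 ≠ 0 := by positivity
  unfold level
  rw [pow_succ]
  field_simp

theorem level_sub_level_succ (a b : ℝ) (n : ℕ) :
    level a b n - level a b (n + 1) = gap a b n := by
  simp only [level, gap, pow_succ, div_mul_eq_div_div]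
  ring

theorem level_antitone {a b : ℝ} (ha : 0 < a) (hb : 0 < b) : Antitone (level a b) :=
  antitone_nat_of_succ_le fun n => by
    have := level_sub_level_succ a b n
    linarith [gap_pos ha hb n]

theorem le_postSurplus {a b x l : ℝ} {w : ℕ → ℝ} (ha : 0 < a) (hl : 0 < l) (hlb : l ≤ b)
    (hlx : l ≤ x) : ∀ {j : ℕ}, (∀ i < j, l ≤ preSurplus a b x w i) → l ≤ postSurplus a b x w j
  | 0, _ => le_min hlx hlb
  | j + 1, h => by
    have := h j (Nat.lt_succ_self j)
    refine le_min ?_ hlb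
    change l ≤ (1 + a) * preSurplus a b x w j
    nlinarith

/-- Between arrivals the surplus falls continuously and jumps only lift it, so it cannot get below l
without meeting l. The inequality on the right is not strict: if the surplus tends to l just as an
arrival occurs, it jumps and l is not attained. -/
theorem le_hittingTime_iff {a b x l : ℝ} {w : ℕ → ℝ} (ha : 0 < a) (hl : 0 < l) (hlb : l ≤ b)
    (hlx : l ≤ x) (hw : ∀ k, 0 < w k) (k : ℕ) :
    ENNReal.ofReal (arrivalTime w k) ≤ hittingTime a b x l w ↔
      ∀ j < k, l ≤ preSurplus a b x w j := by
  have hm := strictMono_arrivalTime hw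
  have h0 : arrivalTime w 0 = 0 := by simp [arrivalTime]
  have hnn : ∀ j, 0 ≤ arrivalTime w j := fun j => h0 ▸ hm.monotone (Nat.zero_le j)
  constructor
  · intro h
    by_contra! hex
    classical
    obtain ⟨hjk, hj⟩ := Nat.find_spec hex
    set j := Nat.find hex
    have hpost : l ≤ postSurplus a b x w j := le_postSurplus ha hl hlb hlx fun i hi => by
      by_contra! hi'
      exact Nat.find_min hex hi ⟨by omega, hi'⟩
    rw [preSurplus] at hj
    -- The time at which the descent after the j-th arrival meets l; by minimality of j it starts at
    -- or above l.
    set t := arrivalTime w j + (postSurplus a b x w j - l) with ht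
    have ht1 : arrivalTime w j ≤ t := by linarith
    have ht2 : t < arrivalTime w (j + 1) := by rw [arrivalTime_succ]; linarith
    have hmem : 0 ≤ t ∧ surplus a b x w t = l :=
      ⟨(hnn j).trans ht1, by rw [surplus_eq_of_mem hw ht1 ht2]; linarith⟩
    have hle : hittingTime a b x l w ≤ ENNReal.ofReal t := iInf₂_le t hmem
    have := (ENNReal.ofReal_le_ofReal_iff hmem.1).1 (h.trans hle)
    linarith [hm.monotone (Nat.succ_le_of_lt hjk)]
  · intro h
    refine le_iInf₂ fun t ⟨ht0, ht⟩ => ENNReal.ofReal_le_ofReal ?_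
    by_contra! hlt
    classical
    have hex : ∃ i, t < arrivalTime w i := ⟨k, hlt⟩
    have hi := Nat.find_spec hex
    have hik : Nat.find hex ≤ k := Nat.find_min' hex hlt
    have hmin := fun m => Nat.find_min (H := hex) (m := m)
    -- Since t precedes the k-th arrival, it lies between two consecutive arrivals, even if the
    -- arrival times accumulate.
    obtain ⟨j, hj⟩ : ∃ j, Nat.find hex = j + 1 := Nat.exists_eq_succ_of_ne_zero fun h => by
      rw [h, h0] at hi; linarith
    rw [hj] at hi hik hmin
    have h1 : arrivalTime w j ≤ t := not_lt.1 (hmin j (Nat.lt_succ_self j))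
    rw [surplus_eq_of_mem hw h1 hi] at ht
    rw [arrivalTime_succ] at hi
    have := h j (by omega)
    rw [preSurplus] at this
    linarith

/-- The discounted dividend paid at the `k`-th arrival, if the level `l` has not been reached
before. -/
noncomputable def payoff (a b q l : ℝ) : ℕ → ℝ → (ℕ → ℝ) → ℝ≥0∞
  | 0, x, _ => ENNReal.ofReal (x - b)
  | k + 1, x, w => (Iic (min x b - l)).indicator
      (fun s => ENNReal.ofReal (Real.exp (-q * s)) *
        payoff a b q l k ((1 + a) * (min x b - s)) (fun i => w (i + 1))) (w 0)

/-- After the first arrival the process starts afresh from the uncapped surplus; the overflow at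
that arrival is the dividend at time 0 of the restarted process. -/
theorem postSurplus_shift (a b x : ℝ) (w : ℕ → ℝ) (k : ℕ) :
    postSurplus a b x w (k + 1) =
      postSurplus a b ((1 + a) * (min x b - w 0)) (fun i => w (i + 1)) k := by
  induction k with
  | zero => rfl
  | succ k ih => rw [postSurplus, ih, postSurplus]

theorem preSurplus_shift (a b x : ℝ) (w : ℕ → ℝ) (k : ℕ) :
    preSurplus a b x w (k + 1) =
      preSurplus a b ((1 + a) * (min x b - w 0)) (fun i => w (i + 1)) k := by
  rw [preSurplus, preSurplus, postSurplus_shift]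

theorem dividend_shift (a b x : ℝ) (w : ℕ → ℝ) (k : ℕ) :
    dividend a b x w (k + 1) =
      dividend a b ((1 + a) * (min x b - w 0)) (fun i => w (i + 1)) k := by
  cases k with
  | zero => rfl
  | succ k => rw [dividend, dividend, preSurplus_shift]

open Classical in
theorem payoff_eq (a b q l : ℝ) (k : ℕ) (x : ℝ) (w : ℕ → ℝ) :
    payoff a b q l k x w = if ∀ j < k, l ≤ preSurplus a b x w j then
      ENNReal.ofReal (dividend a b x w k) * ENNReal.ofReal (Real.exp (-q * arrivalTime w k))
      else 0 := by
  induction k generalizing x w with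
  | zero =>
    simp only [payoff, dividend, arrivalTime, Finset.range_zero, Finset.sum_empty, mul_zero,
      Real.exp_zero, ENNReal.ofReal_one, mul_one, not_lt_zero, false_imp_iff, implies_true, if_true]
    rcases le_total (x - b) 0 with h | h
    · rw [max_eq_right h, ENNReal.ofReal_of_nonpos h, ENNReal.ofReal_zero]
    · rw [max_eq_left h]
  | succ k ih =>
    have hiff : (∀ j < k + 1, l ≤ preSurplus a b x w j) ↔ w 0 ≤ min x b - l ∧
        ∀ j < k, l ≤ preSurplus a b ((1 + a) * (min x b - w 0)) (fun i => w (i + 1)) j := by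
      rw [Nat.forall_lt_succ_left']
      simp only [preSurplus_shift]
      exact and_congr_left fun _ => le_sub_comm
    simp only [payoff, ih, indicator, mem_Iic, hiff]
    by_cases h1 : w 0 ≤ min x b - l
    · rw [if_pos h1]
      simp only [h1, true_and]
      split_ifs
      · rw [dividend_shift, arrivalTime_shift, mul_add, Real.exp_add,
          ENNReal.ofReal_mul (Real.exp_pos _).le]
        ring
      · rw [mul_zero]
    · simp [h1]

/-- The hitting time disappears from the formula, so its measurability as a function of the path is
never needed. -/
theorem discountedDividends_eq_tsum {a b x : ℝ} (q : ℝ) {N : ℕ} {w : ℕ → ℝ} (ha : 0 < a)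
    (hb : 0 < b) (hx : level a b N ≤ x) (hw : ∀ k, 0 < w k) :
    discountedDividends a b q N x w = ∑' k, payoff a b q (level a b N) k x w := by
  have hlb : level a b N ≤ b := (level_antitone ha hb (Nat.zero_le N)).trans_eq (level_zero a b)
  have h0 : arrivalTime w 0 = 0 := by simp [arrivalTime]
  have hnn : ∀ j, 0 ≤ arrivalTime w j := fun j =>
    h0 ▸ (strictMono_arrivalTime hw).monotone (Nat.zero_le j)
  have hS : MeasurableSet
      {t : ℝ | 0 ≤ t ∧ ENNReal.ofReal t ≤ hittingTime a b x (level a b N) w} :=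
    measurableSet_Ici.inter (ENNReal.measurable_ofReal measurableSet_Iic)
  rw [discountedDividends, ← lintegral_indicator hS, dividendMeasure, lintegral_sum_measure]
  refine tsum_congr fun k => ?_
  classical
  rw [lintegral_smul_measure, lintegral_dirac, payoff_eq, indicator_apply, smul_eq_mul]
  simp only [mem_ofPred_eq, hnn k, true_and,
    le_hittingTime_iff ha (level_pos ha hb N) hlb hx hw k, mul_ite, mul_zero]

theorem measurable_payoff (a b q l : ℝ) (k : ℕ) :
    Measurable fun p : ℝ × (ℕ → ℝ) => payoff a b q l k p.1 p.2 := by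
  induction k with
  | zero =>
    simp only [payoff]
    fun_prop
  | succ k ih =>
    have h1 : Measurable fun p : ℝ × (ℕ → ℝ) =>
        ENNReal.ofReal (Real.exp (-q * p.2 0)) *
          payoff a b q l k ((1 + a) * (min p.1 b - p.2 0)) (fun i => p.2 (i + 1)) := by
      refine Measurable.mul (by fun_prop) (ih.comp (Measurable.prodMk (by fun_prop) ?_))
      exact measurable_pi_lambda _ fun i => by fun_prop
    have h2 : MeasurableSet {p : ℝ × (ℕ → ℝ) | p.2 0 ≤ min p.1 b - l} :=
      measurableSet_le (by fun_prop) (by fun_prop)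
    exact h1.indicator h2

/-! ### The expected discounted dividends -/

theorem expMeasure_Iic {lam : ℝ} (hlam : 0 < lam) {x : ℝ} (hx : 0 ≤ x) :
    expMeasure lam (Iic x) = ENNReal.ofReal (1 - Real.exp (-(lam * x))) := by
  have := lintegral_exponentialPDF_eq_antiDeriv hlam x
  rw [if_pos hx] at this
  rw [← this]
  exact withDensity_apply _ measurableSet_Iic

theorem ae_pos_expMeasure {lam : ℝ} (hlam : 0 < lam) : ∀ᵐ s ∂(expMeasure lam), 0 < s := by
  have h : expMeasure lam (Iic 0) = 0 := by simp [expMeasure_Iic hlam le_rfl]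
  filter_upwards [measure_eq_zero_iff_ae_notMem.1 h] with s hs
  exact not_le.1 hs

theorem lintegral_expMeasure {lam : ℝ} {f : ℝ → ℝ≥0∞} (hf : Measurable f) :
    ∫⁻ s, f s ∂(expMeasure lam) = ∫⁻ s, exponentialPDF lam s * f s :=
  lintegral_withDensity_eq_lintegral_mul _ (measurable_exponentialPDFReal lam).ennreal_ofReal hf

/-- The expectation of `payoff`. -/
noncomputable def meanPayoff (a b q l lam : ℝ) : ℕ → ℝ → ℝ≥0∞
  | 0, x => ENNReal.ofReal (x - b)
  | k + 1, x => ∫⁻ s, (Iic (min x b - l)).indicator (fun s => ENNReal.ofReal (Real.exp (-q * s)) *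
      meanPayoff a b q l lam k ((1 + a) * (min x b - s))) s ∂(expMeasure lam)

theorem indepFun_zero_shift {Ω : Type*} [MeasurableSpace Ω] {P : Measure Ω}
    [IsProbabilityMeasure P] {ξ : ℕ → Ω → ℝ} (hm : ∀ k, Measurable (ξ k)) (hi : iIndepFun ξ P) :
    IndepFun (ξ 0) (fun ω k => ξ (k + 1) ω) P := by
  -- The σ-algebras generated over disjoint index sets are independent.
  have h := indep_iSup_of_disjoint (fun k => (hm k).comap_le) hi
    (S := {0}) (T := {k | k ≠ 0}) (by simp)
  refine indep_of_indep_of_le_left (indep_of_indep_of_le_right h ?_) ?_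
  · simp only [MeasurableSpace.pi, MeasurableSpace.comap_iSup, MeasurableSpace.comap_comp]
    exact iSup_le fun k => le_iSup₂_of_le (k + 1) (Nat.succ_ne_zero k) le_rfl
  · exact le_iSup₂_of_le 0 rfl le_rfl

/-- Fubini for the product law of ξ 0 and the shifted sequence. The shifted sequence satisfies the
same hypotheses, so the induction runs over all ξ. -/
theorem lintegral_payoff {Ω : Type*} [MeasurableSpace Ω] {P : Measure Ω}
    [IsProbabilityMeasure P] (a b q l : ℝ) {lam : ℝ} (hlam : 0 < lam) (k : ℕ)
    {ξ : ℕ → Ω → ℝ} (hm : ∀ k, Measurable (ξ k)) (hi : iIndepFun ξ P)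
    (hlaw : ∀ k, P.map (ξ k) = expMeasure lam) (x : ℝ) :
    ∫⁻ ω, payoff a b q l k x (fun i => ξ i ω) ∂P = meanPayoff a b q l lam k x := by
  have := isProbabilityMeasure_expMeasure hlam
  induction k generalizing ξ x with
  | zero => simp [payoff, meanPayoff]
  | succ k ih =>
    have hms : Measurable fun ω k => ξ (k + 1) ω := measurable_pi_lambda _ fun k => hm (k + 1)
    have hprod := (indepFun_iff_map_prod_eq_prod_map_map (hm 0).aemeasurable
      hms.aemeasurable).1 (indepFun_zero_shift hm hi)
    rw [hlaw 0] at hprod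
    set G : ℝ × (ℕ → ℝ) → ℝ≥0∞ := fun p => (Iic (min x b - l)).indicator
      (fun s => ENNReal.ofReal (Real.exp (-q * s)) *
        payoff a b q l k ((1 + a) * (min x b - s)) p.2) p.1 with hG
    have hGm : Measurable G := by
      have h1 : Measurable fun p : ℝ × (ℕ → ℝ) => ENNReal.ofReal (Real.exp (-q * p.1)) *
          payoff a b q l k ((1 + a) * (min x b - p.1)) p.2 :=
        Measurable.mul (by fun_prop)
          ((measurable_payoff a b q l k).comp (Measurable.prodMk (by fun_prop) (by fun_prop)))
      exact h1.indicator (measurable_fst measurableSet_Iic)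
    have h1 : ∫⁻ ω, payoff a b q l (k + 1) x (fun i => ξ i ω) ∂P =
        ∫⁻ p, G p ∂(P.map fun ω => (ξ 0 ω, fun k => ξ (k + 1) ω)) := by
      rw [lintegral_map hGm ((hm 0).prodMk hms)]
      rfl
    have : SFinite (P.map fun ω k => ξ (k + 1) ω) := inferInstance
    rw [h1, hprod, lintegral_prod _ hGm.aemeasurable, meanPayoff]
    refine lintegral_congr fun s => ?_
    rw [lintegral_map (f := fun p => G (s, p)) (hGm.comp measurable_prodMk_left) hms]
    simp only [hG]
    by_cases hs : s ∈ Iic (min x b - l)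
    · simp only [indicator_of_mem hs]
      rw [lintegral_const_mul]
      · rw [ih (fun k => hm (k + 1)) (hi.precomp (add_left_injective 1)) fun k => hlaw (k + 1)]
      · exact (measurable_payoff a b q l k).comp (measurable_prodMk_left.comp hms)
    · simp [indicator_of_notMem hs]

theorem measurable_meanPayoff (a b q l : ℝ) {lam : ℝ} (hlam : 0 < lam) (k : ℕ) :
    Measurable (meanPayoff a b q l lam k) := by
  have := isProbabilityMeasure_expMeasure hlam
  induction k with
  | zero =>
    simp only [meanPayoff]
    fun_prop
  | succ k ih =>
    have h1 : Measurable fun p : ℝ × ℝ => ENNReal.ofReal (Real.exp (-q * p.2)) *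
          meanPayoff a b q l lam k ((1 + a) * (min p.1 b - p.2)) := by
      fun_prop
    have h2 : MeasurableSet {p : ℝ × ℝ | p.2 ≤ min p.1 b - l} :=
      measurableSet_le (by fun_prop) (by fun_prop)
    exact (h1.indicator h2).lintegral_prod_right'

/-- The capped surplus is at most b, so an arrival before level l requires an interarrival time at
most b. The bound (1 + a) * b on the starting point is inherited after each arrival and limits every
overflow to a * b. -/
theorem meanPayoff_le {a b q l lam : ℝ} (ha : 0 < a) (hq : 0 ≤ q) (hl : 0 < l)
    (hlam : 0 < lam) (k : ℕ) {x : ℝ} (hx : x ≤ (1 + a) * b) :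
    meanPayoff a b q l lam k x ≤ ENNReal.ofReal (a * b) * expMeasure lam (Iic b) ^ k := by
  induction k generalizing x with
  | zero =>
    rw [meanPayoff, pow_zero, mul_one]
    exact ENNReal.ofReal_le_ofReal (by linarith)
  | succ k ih =>
    rw [meanPayoff, pow_succ, ← mul_assoc, ← lintegral_indicator_const measurableSet_Iic]
    refine lintegral_mono_ae ?_
    filter_upwards [ae_pos_expMeasure hlam] with s hs
    have hmin : min x b ≤ b := min_le_right _ _
    by_cases h : s ∈ Iic (min x b - l)
    · have h' : s ∈ Iic b := mem_Iic.2 (by linarith [mem_Iic.1 h])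
      rw [indicator_of_mem h, indicator_of_mem h']
      refine (mul_le_of_le_one_left (zero_le) ?_).trans (ih ?_)
      · rw [ENNReal.ofReal_le_one, Real.exp_le_one_iff]
        nlinarith
      · exact mul_le_mul_of_nonneg_left (by linarith) (by linarith)
    · rw [indicator_of_notMem h]
      exact zero_le

theorem exists_tsum_meanPayoff_le {a b q l lam : ℝ} (ha : 0 < a) (hb : 0 < b) (hq : 0 ≤ q)
    (hl : 0 < l) (hlam : 0 < lam) :
    ∃ C : ℝ≥0∞, C ≠ ⊤ ∧ ∀ x ≤ (1 + a) * b, ∑' k, meanPayoff a b q l lam k x ≤ C := by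
  refine ⟨∑' k, ENNReal.ofReal (a * b) * expMeasure lam (Iic b) ^ k, ?_,
    fun x hx => ENNReal.tsum_le_tsum fun k => meanPayoff_le ha hq hl hlam k hx⟩
  rw [ENNReal.tsum_mul_left, ENNReal.tsum_geometric]
  refine ENNReal.mul_ne_top ENNReal.ofReal_ne_top (ENNReal.inv_ne_top.2 ?_)
  rw [ne_eq, tsub_eq_zero_iff_le, not_le, expMeasure_Iic hlam hb.le, ENNReal.ofReal_lt_one]
  linarith [Real.exp_pos (-(lam * b))]

/-- The sum of the expected payoffs, as a real number. -/
noncomputable def payoffSum (a b q l lam x : ℝ) : ℝ := (∑' k, meanPayoff a b q l lam k x).toReal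

theorem expectedDividends_eq {Ω : Type*} [MeasurableSpace Ω] {P : Measure Ω}
    [IsProbabilityMeasure P] {a b q lam : ℝ} (ha : 0 < a) (hb : 0 < b) (hlam : 0 < lam)
    {ξ : ℕ → Ω → ℝ} (hm : ∀ k, Measurable (ξ k)) (hi : iIndepFun ξ P)
    (hlaw : ∀ k, P.map (ξ k) = expMeasure lam) {N : ℕ} {x : ℝ} (hx : level a b N ≤ x) :
    expectedDividends P ξ a b q N x = ∑' k, meanPayoff a b q (level a b N) lam k x := by
  have hpos : ∀ᵐ ω ∂P, ∀ k, 0 < ξ k ω := ae_all_iff.2 fun k => by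
    have := ae_pos_expMeasure hlam
    rw [← hlaw k] at this
    exact ae_of_ae_map (hm k).aemeasurable this
  have hms : Measurable fun ω k => ξ k ω := measurable_pi_lambda _ hm
  rw [expectedDividends]
  rw [lintegral_congr_ae (hpos.mono fun ω hω => discountedDividends_eq_tsum q ha hb hx hω),
    lintegral_tsum (f := fun k ω => payoff a b q (level a b N) k x fun i => ξ i ω) fun k =>
      ((measurable_payoff a b q _ k).comp (measurable_prodMk_left.comp hms)).aemeasurable]
  exact tsum_congr fun k => lintegral_payoff a b q _ hlam k hm hi hlaw x

theorem measurable_tsum_meanPayoff (a b q l : ℝ) {lam : ℝ} (hlam : 0 < lam) :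
    Measurable fun x => ∑' k, meanPayoff a b q l lam k x :=
  Measurable.tsum (measurable_meanPayoff a b q l hlam)

theorem measurable_payoffSum (a b q l : ℝ) {lam : ℝ} (hlam : 0 < lam) :
    Measurable (payoffSum a b q l lam) :=
  (measurable_tsum_meanPayoff a b q l hlam).ennreal_toReal

theorem exists_abs_payoffSum_le {a b q l lam : ℝ} (ha : 0 < a) (hb : 0 < b) (hq : 0 ≤ q)
    (hl : 0 < l) (hlam : 0 < lam) :
    ∃ C : ℝ, ∀ x ≤ (1 + a) * b, |payoffSum a b q l lam x| ≤ C := by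
  obtain ⟨C, hC, h⟩ := exists_tsum_meanPayoff_le (q := q) ha hb hq hl hlam
  refine ⟨C.toReal, fun x hx => ?_⟩
  rw [payoffSum, abs_of_nonneg ENNReal.toReal_nonneg]
  exact ENNReal.toReal_mono hC (h x hx)

/-- Only the payoff at time 0 sees the excess over b; the later ones depend on x through `min x b`.
-/
theorem payoffSum_of_ge {a b q l lam : ℝ} (ha : 0 < a) (hb : 0 < b) (hq : 0 ≤ q)
    (hl : 0 < l) (hlam : 0 < lam) {x : ℝ} (hx : b ≤ x) :
    payoffSum a b q l lam x = payoffSum a b q l lam b + (x - b) := by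
  obtain ⟨C, hC, h⟩ := exists_tsum_meanPayoff_le (q := q) ha hb hq hl hlam
  have hfin : ∑' k, meanPayoff a b q l lam k b ≠ ⊤ :=
    ne_top_of_le_ne_top hC (h b (by nlinarith))
  have hs : ∀ k, meanPayoff a b q l lam (k + 1) x = meanPayoff a b q l lam (k + 1) b := by
    intro k
    simp only [meanPayoff, min_eq_right hx, min_self]
  have h0 : meanPayoff a b q l lam 0 b = 0 := by simp [meanPayoff]
  have hsum : ∑' k, meanPayoff a b q l lam k x =
      ∑' k, meanPayoff a b q l lam k b + ENNReal.ofReal (x - b) := by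
    rw [tsum_eq_zero_add' ENNReal.summable, tsum_eq_zero_add' (f := fun k => meanPayoff a b q l lam k b)
      ENNReal.summable, h0, zero_add, add_comm, tsum_congr hs]
    rfl
  rw [payoffSum, payoffSum, hsum, ENNReal.toReal_add hfin ENNReal.ofReal_ne_top,
    ENNReal.toReal_ofReal (by linarith)]

theorem intervalIntegrable_payoffSum {a b q l lam : ℝ} (ha : 0 < a) (hb : 0 < b) (hq : 0 ≤ q)
    (hl : 0 < l) (hlam : 0 < lam) {x c d : ℝ} (hx : x ≤ b) (hc : 0 ≤ c) (hcd : c ≤ d) :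
    IntervalIntegrable (fun s => gdens lam q 1 s * payoffSum a b q l lam ((1 + a) * (x - s)))
      volume c d := by
  obtain ⟨C, hC⟩ := exists_abs_payoffSum_le (q := q) ha hb hq hl hlam
  refine IntervalIntegrable.continuousOn_mul ?_ (continuous_gdens _ _ _).continuousOn
  rw [intervalIntegrable_iff_integrableOn_Ioc_of_le hcd]
  refine Measure.integrableOn_of_bounded (M := C) measure_Ioc_lt_top.ne
    ((measurable_payoffSum a b q l hlam).comp (by fun_prop)).aestronglyMeasurable ?_
  refine (ae_restrict_iff' measurableSet_Ioc).2 (ae_of_all _ fun s hs => ?_)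
  exact hC _ (mul_le_mul_of_nonneg_left (by linarith [hs.1]) (by linarith))

/-- The renewal equation. -/
theorem payoffSum_eq_integral {a b q l lam : ℝ} (ha : 0 < a) (hb : 0 < b) (hq : 0 ≤ q)
    (hl : 0 < l) (hlam : 0 < lam) {x : ℝ} (hlx : l ≤ x) (hx : x ≤ b) :
    payoffSum a b q l lam x =
      ∫ s in (0 : ℝ)..(x - l), gdens lam q 1 s * payoffSum a b q l lam ((1 + a) * (x - s)) := by
  obtain ⟨C, hC, hCb⟩ := exists_tsum_meanPayoff_le (q := q) ha hb hq hl hlam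
  have hVm := measurable_tsum_meanPayoff a b q l hlam
  set V : ℝ → ℝ≥0∞ := fun x => ∑' k, meanPayoff a b q l lam k x with hV
  have hKm : Measurable fun s => ENNReal.ofReal (Real.exp (-q * s)) * V ((1 + a) * (x - s)) :=
    Measurable.mul (by fun_prop) (hVm.comp (by fun_prop))
  have h1 : V x = ∫⁻ s, (Iic (x - l)).indicator (fun s => ENNReal.ofReal (Real.exp (-q * s)) *
      V ((1 + a) * (x - s))) s ∂(expMeasure lam) := by
    have h0 : meanPayoff a b q l lam 0 x = 0 := by
      simpa [meanPayoff] using hx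
    simp only [hV]
    rw [tsum_eq_zero_add' ENNReal.summable, h0, zero_add]
    simp only [meanPayoff, min_eq_left hx]
    rw [← lintegral_tsum]
    · refine lintegral_congr fun s => ?_
      by_cases hs : s ∈ Iic (x - l)
      · simp only [indicator_of_mem hs, ENNReal.tsum_mul_left]
      · simp only [indicator_of_notMem hs, tsum_zero]
    · intro k
      have := measurable_meanPayoff a b q l hlam k
      exact (Measurable.indicator (by fun_prop) measurableSet_Iic).aemeasurable
  -- The discount factor times the exponential density is g_1; the point s = 0 is null.
  have h2 : V x = ∫⁻ s in Ioc 0 (x - l), ENNReal.ofReal (gdens lam q 1 s) *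
      V ((1 + a) * (x - s)) := by
    rw [h1, lintegral_expMeasure (hKm.indicator measurableSet_Iic),
      ← lintegral_indicator measurableSet_Ioc]
    refine lintegral_congr_ae ?_
    filter_upwards [measure_eq_zero_iff_ae_notMem.1 (Real.volume_singleton (a := 0))] with s hs
    rcases lt_or_gt_of_ne (show s ≠ 0 from hs) with hs | hs
    · rw [exponentialPDF_of_neg hs, zero_mul, indicator_of_notMem]
      exact fun h => not_lt.2 hs.le h.1
    · by_cases hsx : s ≤ x - l
      · rw [indicator_of_mem (show s ∈ Iic (x - l) from hsx),
          indicator_of_mem (show s ∈ Ioc 0 (x - l) from ⟨hs, hsx⟩),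
          exponentialPDF_of_nonneg hs.le, ← mul_assoc, ← ENNReal.ofReal_mul (by positivity)]
        congr 2
        rw [gdens, mul_assoc, ← Real.exp_add]
        ring_nf
      · rw [indicator_of_notMem (show s ∉ Iic (x - l) from hsx),
          indicator_of_notMem (fun h => hsx h.2), mul_zero]
  have hg := continuous_gdens lam q 1
  change (V x).toReal = _
  rw [h2, intervalIntegral.integral_of_le (by linarith), ← integral_toReal]
  · refine setIntegral_congr_fun measurableSet_Ioc fun s _ => ?_
    simp only [ENNReal.toReal_mul]
    rw [ENNReal.toReal_ofReal (by unfold gdens; positivity)]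
    rfl
  · exact (Measurable.mul (by fun_prop) (hVm.comp (by fun_prop))).aemeasurable
  · refine (ae_restrict_iff' measurableSet_Ioc).2 (ae_of_all _ fun s hs => ?_)
    refine ENNReal.mul_lt_top ENNReal.ofReal_lt_top ((hCb _ ?_).trans_lt hC.lt_top)
    exact mul_le_mul_of_nonneg_left (by linarith [hs.1]) (by linarith)

/-- The lack of memory of the exponential distribution: the renewal equation, restarted when the
surplus reaches `z` before the first arrival. -/
theorem payoffSum_add {a b q l lam : ℝ} (ha : 0 < a) (hb : 0 < b) (hq : 0 ≤ q)
    (hl : 0 < l) (hlam : 0 < lam) {z y : ℝ} (hz : l ≤ z) (hy : 0 ≤ y) (hzy : z + y ≤ b) :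
    payoffSum a b q l lam (z + y) = Gbar lam q 1 y * payoffSum a b q l lam z +
      conv (fun t => payoffSum a b q l lam ((1 + a) * z + (a + 1) * t)) (gdens lam q 1) y := by
  have hint := fun {c d : ℝ} (hc : 0 ≤ c) (hcd : c ≤ d) =>
    intervalIntegrable_payoffSum (q := q) (x := z + y) ha hb hq hl hlam hzy hc hcd
  -- Split at s = y, when a path without arrivals passes z. The part after y is Ḡ_1(y) times the
  -- renewal integral at z; the part before becomes the convolution under s = y - t.
  rw [payoffSum_eq_integral ha hb hq hl hlam (x := z + y) (by linarith) hzy,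
    ← intervalIntegral.integral_add_adjacent_intervals (hint le_rfl hy)
      (hint (d := z + y - l) hy (by linarith)), add_comm]
  congr 1
  · rw [payoffSum_eq_integral ha hb hq hl hlam hz (by linarith),
      ← intervalIntegral.integral_const_mul]
    have := intervalIntegral.integral_comp_add_right (a := 0) (b := z - l)
      (fun s => gdens lam q 1 s * payoffSum a b q l lam ((1 + a) * (z + y - s))) y
    rw [zero_add, show z - l + y = z + y - l by ring] at this
    rw [← this]
    refine intervalIntegral.integral_congr fun s _ => ?_
    simp only [gdens, Gbar]
    rw [show -(lam + q) * 1 * (s + y) = -(lam + q) * 1 * y + -(lam + q) * 1 * s by ring,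
      Real.exp_add, show z + y - (s + y) = z - s by ring]
    ring
  · rw [conv_apply _ _ hy]
    have := intervalIntegral.integral_comp_sub_left (a := 0) (b := y)
      (fun s => gdens lam q 1 s * payoffSum a b q l lam ((1 + a) * (z + y - s))) y
    rw [sub_zero, sub_self] at this
    rw [← this]
    refine intervalIntegral.integral_congr fun t _ => ?_
    rw [mul_comm, show (1 + a) * (z + y - (y - t)) = (1 + a) * z + (a + 1) * t by ring]

theorem payoffSum_eq_expansion {a b q lam : ℝ} (ha : 0 < a) (hb : 0 < b) (hq : 0 ≤ q)
    (hlam : 0 < lam) (N n : ℕ) (hn : n < N) {y : ℝ} (hy : 0 ≤ y) (hyn : y ≤ gap a b n) :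
    payoffSum a b q (level a b N) lam (level a b (n + 1) + y) =
      expansion a lam q 1 (fun k => payoffSum a b q (level a b N) lam (level a b k)) (n + 1) y := by
  have hl := level_pos ha hb N
  have hgap := level_sub_level_succ a b
  have hb0 : ∀ k, level a b k ≤ b := fun k =>
    (level_antitone ha hb (Nat.zero_le k)).trans_eq (level_zero a b)
  induction n generalizing y with
  | zero =>
    rw [payoffSum_add ha hb hq hl hlam (level_antitone ha hb hn) hy
      (by linarith [hgap 0, hb0 0]), expansion_succ lam q ha]
    congr 1
    refine conv_congr fun t ht _ => ?_
    -- A jump from at least L_1 lands at or above b, where the value is affine and equals the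
    -- expansion of order 0.
    have := mul_nonneg (by linarith : 0 ≤ a + 1) ht
    rw [add_comm 1 a, level_succ ha, level_zero, expansion_zero, level_zero,
      payoffSum_of_ge ha hb hq hl hlam (by linarith)]
    ring
  | succ n ih =>
    rw [payoffSum_add ha hb hq hl hlam (level_antitone ha hb hn) hy
      (by linarith [hgap (n + 1), hb0 (n + 1)]), expansion_succ lam q ha]
    congr 1
    refine conv_congr fun t ht hty => ?_
    rw [add_comm 1 a, level_succ ha, ih (by omega) (by positivity)]
    -- The jump maps each interval between levels exactly onto the one above, so the dilated offset
    -- stays in the range of the induction hypothesis.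
    have h1 : (a + 1) * gap a b (n + 1) = gap a b n := by
      rw [← hgap, ← hgap, mul_sub, level_succ ha, level_succ ha]
    rw [← h1]
    exact mul_le_mul_of_nonneg_left (hty.trans hyn) (by linarith)

end DualRisk

/-! ### Transfer of the results to the value function -/

theorem mainTheorem4 {Ω : Type*} [MeasurableSpace Ω] (P : Measure Ω) [IsProbabilityMeasure P]
    (a b q lam : ℝ) (ha : 0 < a) (hb : 0 < b) (hq : 0 ≤ q) (hlam : 0 < lam)
    (ξ : ℕ → Ω → ℝ) (hξ_meas : ∀ k, Measurable (ξ k)) (hξ_indep : iIndepFun ξ P)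
    (hξ_law : ∀ k, P.map (ξ k) = expMeasure lam)
    (N : ℕ) (hN : 1 ≤ N) :
    -- the expectations are finite
    (∀ x : ℝ, DualRisk.level a b N ≤ x → x ≤ b →
      DualRisk.expectedDividends P ξ a b q N x ≠ ⊤) ∧
    -- the boundary value
    DualRisk.valueN P ξ a b q N (DualRisk.level a b N) = 0 ∧
    -- the convolution expansion
    (∀ n : ℕ, 1 ≤ n → n ≤ N → ∀ x : ℝ,
      DualRisk.level a b n < x → x ≤ DualRisk.level a b (n - 1) →
      DualRisk.valueN P ξ a b q N x =
        (∑ j ∈ Finset.range n, DualRisk.gammaFun a lam q j (x - DualRisk.level a b n) *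
            DualRisk.valueN P ξ a b q N (DualRisk.level a b (n - j)))
        + DualRisk.omegaFun a lam q n (x - DualRisk.level a b n) * DualRisk.valueN P ξ a b q N b
        + DualRisk.deltaFun a lam q n (x - DualRisk.level a b n)) ∧
    -- the linear system for `V = (v_0, …, v_{N-1})`, and its solution
    (∀ V : Fin N → ℝ, V = (fun n : Fin N => DualRisk.valueN P ξ a b q N (DualRisk.level a b (n : ℕ))) →
      V = (DualRisk.Psi a b lam q N).mulVec V + DualRisk.Delta a b lam q N ∧
      IsUnit (1 - DualRisk.Psi a b lam q N) ∧
      V = (1 - DualRisk.Psi a b lam q N)⁻¹.mulVec (DualRisk.Delta a b lam q N)) := by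
  have hl := DualRisk.level_pos ha hb N
  have hb0 : ∀ k, DualRisk.level a b k ≤ b := fun k =>
    (DualRisk.level_antitone ha hb (Nat.zero_le k)).trans_eq (DualRisk.level_zero a b)
  set L := DualRisk.level a b with hL
  set u := DualRisk.payoffSum a b q (L N) lam with hu
  have hE := fun {x : ℝ} (hx : L N ≤ x) =>
    DualRisk.expectedDividends_eq (q := q) ha hb hlam hξ_meas hξ_indep hξ_law hx
  have hval : ∀ x, L N ≤ x → DualRisk.valueN P ξ a b q N x = u x := fun x hx => by
    rw [DualRisk.valueN, hE hx]; rfl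
  -- At the lowest level the renewal integral runs over an interval of length 0.
  have huN : u (L N) = 0 := by
    rw [hu, DualRisk.payoffSum_eq_integral ha hb hq hl hlam le_rfl (hb0 N)]
    simp
  have hexp : ∀ n : ℕ, 1 ≤ n → n ≤ N → ∀ x : ℝ, L n < x → x ≤ L (n - 1) →
      u x = DualRisk.expansion a lam q 1 (fun k => u (L k)) n (x - L n) := by
    intro n h1 hn x hx1 hx2
    obtain ⟨n, rfl⟩ := Nat.exists_eq_add_of_le' h1
    have hgap := DualRisk.level_sub_level_succ a b n
    rw [Nat.add_sub_cancel] at hx2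
    have := DualRisk.payoffSum_eq_expansion (q := q) ha hb hq hlam N n hn
      (y := x - L (n + 1)) (by linarith) (by linarith)
    rwa [add_sub_cancel] at this
  refine ⟨fun x hx hxb => ?_, ?_, fun n h1 hn x hx1 hx2 => ?_, fun V hV => ?_⟩
  · obtain ⟨C, hC, h⟩ := DualRisk.exists_tsum_meanPayoff_le (q := q) ha hb hq hl hlam
    rw [hE hx]
    exact ne_top_of_le_ne_top hC (h x (by nlinarith))
  · rw [hval _ le_rfl, huN]
  · have hanti := DualRisk.level_antitone ha hb
    rw [hval x ((hanti hn).trans hx1.le), hexp n h1 hn x hx1 hx2, DualRisk.expansion, mul_one,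
      hval b (hb0 N), hL, DualRisk.level_zero]
    congr 2
    refine Finset.sum_congr rfl fun j _ => ?_
    rw [hval _ (hanti (by omega))]
  · have hVu : V = fun n : Fin N => u (L n) := by
      rw [hV]
      ext n
      exact hval _ (DualRisk.level_antitone ha hb n.2.le)
    have hsys : V = (DualRisk.Psi a b lam q N).mulVec V + DualRisk.Delta a b lam q N := by
      ext n
      have hgap := DualRisk.level_sub_level_succ a b n
      have hpos := DualRisk.gap_pos ha hb n
      rw [Pi.add_apply, hVu, DualRisk.Psi_mulVec a b lam q N (fun k => u (L k)) huN n]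
      change u (L n) = _
      -- Row n of the system is the expansion at the upper end L_n of its interval, where the offset
      -- is the gap.
      rw [hexp (n + 1) (by omega) n.2 (L n) (by linarith) le_rfl, hgap]
      simp only [DualRisk.expansion, DualRisk.Delta]
      ring
    have hunit := DualRisk.isUnit_one_sub_Psi (b := b) ha hb hlam hq N
    refine ⟨hsys, hunit, ?_⟩
    have h1 : (1 - DualRisk.Psi a b lam q N).mulVec V = DualRisk.Delta a b lam q N := by
      rw [Matrix.sub_mulVec, Matrix.one_mulVec, sub_eq_iff_eq_add']
      exact hsys
    rw [← h1, Matrix.mulVec_mulVec, Matrix.nonsing_inv_mul _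
      ((Matrix.isUnit_iff_isUnit_det _).1 hunit), Matrix.one_mulVec]
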